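/- Let $\mathbf{PZLC}$ be the category whose objects are the Boolean spaces, i.e. the zero-dimensional (having a base of clopen sets) locally compact Hausdorff spaces, the empty space included, and whose morphisms are the perfect maps, i.e. the continuous closed maps $f:X\to Y$ such that $f^{-1}(y)$ is compact for every $y\in Y$. A generalized Boolean pseudolattice is a distributive lattice $A$ with a least element $0$ (and not necessarily with a greatest one) such that for all $a,b,c\in A$ with $b\le a\le c$ there exists $x\in A$ with $a\wedge x=b$ and $a\vee x=c$. Let $\mathbf{GBPL}$ be the category whose objects are the generalized Boolean pseudolattices and whose morphisms $\varphi:A\to B$ are the maps that preserve binary meets, binary joins and $0$ and satisfy the condition (LBA) for every $b\in B$ there exists $a\in A$ such that $b\le\varphi(a)$. Then $\mathbf{PZLC}$ is dually equivalent to $\mathbf{GBPL}$. As a consequence, there is a bijection between the class of all Boolean spaces up to homeomorphism and the class of all generalized Boolean pseudolattices up to isomorphism in $\mathbf{GBPL}$, namely the one induced by the object map of the duality. -/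

import Mathlib

open CategoryTheory

universe u v w

/-- A topological space is zero-dimensional if its clopen subsets form a base. -/
def IsZeroDimensional (X : Type u) [TopologicalSpace X] : Prop :=
  TopologicalSpace.IsTopologicalBasis {s : Set X | IsClopen s}

/-- A perfect map: a (continuous) closed map all of whose point inverses are compact. -/
structure IsPerfectMap {X : Type u} {Y : Type v} [TopologicalSpace X] [TopologicalSpace Y]
    (f : X → Y) : Prop where
  continuous : Continuous f
  isClosedMap : IsClosedMap f
  isCompact_fiber : ∀ y : Y, IsCompact (f ⁻¹' {y})

theorem IsPerfectMap.id {X : Type u} [TopologicalSpace X] :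
    IsPerfectMap (fun x : X => x) where
  continuous := continuous_id
  isClosedMap := IsClosedMap.id
  isCompact_fiber y := by
    have h : (fun x : X => x) ⁻¹' {y} = {y} := rfl
    rw [h]
    exact isCompact_singleton

theorem IsPerfectMap.comp {X : Type u} {Y : Type v} {Z : Type w} [TopologicalSpace X]
    [TopologicalSpace Y] [TopologicalSpace Z] {g : Y → Z} {f : X → Y}
    (hg : IsPerfectMap g) (hf : IsPerfectMap f) : IsPerfectMap (fun x => g (f x)) where
  continuous := hg.continuous.comp hf.continuous
  isClosedMap := hg.isClosedMap.comp hf.isClosedMap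
  isCompact_fiber z :=
    (isProperMap_iff_isClosedMap_and_compact_fibers.2
      ⟨hf.continuous, hf.isClosedMap, fun {y} => hf.isCompact_fiber y⟩).isCompact_preimage
        (hg.isCompact_fiber z)

/-- The objects of the category `PZLC`: the Boolean spaces, i.e. the zero-dimensional
locally compact Hausdorff spaces. -/
structure PZLC : Type (u + 1) where
  carrier : Type u
  [topologicalSpace : TopologicalSpace carrier]
  [t2Space : T2Space carrier]
  [locallyCompactSpace : LocallyCompactSpace carrier]
  isZeroDimensional : IsZeroDimensional carrier

namespace PZLC

instance : CoeSort PZLC.{u} (Type u) := ⟨PZLC.carrier⟩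

attribute [instance] topologicalSpace t2Space locallyCompactSpace

/-- The morphisms of `PZLC` are the perfect maps. -/
@[ext]
structure Hom (X Y : PZLC.{u}) : Type u where
  toFun : X → Y
  isPerfectMap : IsPerfectMap toFun

/-- The category of Boolean spaces and perfect maps. -/
instance : Category PZLC.{u} where
  Hom X Y := Hom X Y
  id X := ⟨fun x => x, IsPerfectMap.id⟩
  comp f g := ⟨fun x => g.toFun (f.toFun x), g.isPerfectMap.comp f.isPerfectMap⟩

/-- Two Boolean spaces are identified if they are homeomorphic. -/
def homeomorphicSetoid : Setoid PZLC.{u} where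
  r X Y := Nonempty (X ≃ₜ Y)
  iseqv :=
    ⟨fun X => ⟨Homeomorph.refl X⟩, fun ⟨h⟩ => ⟨h.symm⟩, fun ⟨h⟩ ⟨k⟩ => ⟨h.trans k⟩⟩

end PZLC

/-- The objects of the category `GBPL`: the generalized Boolean pseudolattices, i.e. the
distributive lattices with a least element (a greatest element need not exist) in which every
element `a` of an interval `[b, c]` has a complement relative to that interval. -/
structure GBPL : Type (u + 1) where
  carrier : Type u
  [distribLattice : DistribLattice carrier]
  [orderBot : OrderBot carrier]
  exists_relative_complement :
    ∀ a b c : carrier, b ≤ a → a ≤ c → ∃ x : carrier, a ⊓ x = b ∧ a ⊔ x = c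

namespace GBPL

instance : CoeSort GBPL.{u} (Type u) := ⟨GBPL.carrier⟩

attribute [instance] distribLattice orderBot

/-- The morphisms of `GBPL`: the maps that preserve binary joins, binary meets and the least
element, and satisfy the condition (LBA) that every element of the codomain lies below an
element of the image. -/
@[ext]
structure Hom (A B : GBPL.{u}) : Type u where
  toFun : A → B
  map_sup : ∀ a b : A, toFun (a ⊔ b) = toFun a ⊔ toFun b
  map_inf : ∀ a b : A, toFun (a ⊓ b) = toFun a ⊓ toFun b
  map_bot : toFun ⊥ = ⊥
  exists_le : ∀ b : B, ∃ a : A, b ≤ toFun a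

/-- The composite of two morphisms, `f` first. -/
def Hom.comp {A B C : GBPL.{u}} (f : Hom A B) (g : Hom B C) : Hom A C where
  toFun a := g.toFun (f.toFun a)
  map_sup a b := by rw [f.map_sup, g.map_sup]
  map_inf a b := by rw [f.map_inf, g.map_inf]
  map_bot := by rw [f.map_bot, g.map_bot]
  exists_le c := by
    obtain ⟨b, hb⟩ := g.exists_le c
    obtain ⟨a, ha⟩ := f.exists_le b
    have hg : g.toFun b ≤ g.toFun (f.toFun a) := by
      rw [← sup_eq_right, ← g.map_sup, sup_eq_right.2 ha]
    exact ⟨a, hb.trans hg⟩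

/-- The category of generalized Boolean pseudolattices. -/
instance : Category GBPL.{u} where
  Hom A B := Hom A B
  id A := ⟨fun a => a, fun _ _ => rfl, fun _ _ => rfl, rfl, fun b => ⟨b, le_rfl⟩⟩
  comp f g := f.comp g

end GBPL

/-!
The duality is the restriction of Stone duality to locally compact spaces. The functor
`compactOpensFunctor` sends a Boolean space `X` to its lattice of compact open sets, and a perfect
map `f` to `U ↦ f ⁻¹' U`: preimages of compact sets under perfect maps are compact, and (LBA)
holds because the image of a compact open set is compact, hence lies in a compact open set.
This functor is an equivalence for three reasons.

* It is faithful, since the compact open sets of a Boolean space form a base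
  (`exists_compactOpens_mem_subset`) and so separate points.
* It is full. Given a morphism `φ` from the compact opens of `Y` to those of `X` and a point `x`,
  the compact open sets `U` with `x ∈ φ U` form a down-directed family of nonempty compact sets,
  and the family is not empty by (LBA). Any point `y` of its intersection satisfies
  `y ∈ U ↔ x ∈ φ U` for all `U` (`exists_point_of_hom`): if `y ∈ U` but `x ∉ φ U`, then
  subtracting `U` from a member of the family gives a member that misses `y`. Thus `x ↦ y` is a
  map whose inverse image operation is `φ`; it is continuous and proper because every `φ U` is
  open and compact.
* It is essentially surjective. A generalized Boolean pseudolattice `A` is the lattice of compact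
  opens of `Spectrum A`, the space of nonzero lattice homomorphisms from `A` to the two-element
  lattice with the topology of pointwise convergence. The sets `basicOpen a` are compact, being
  closed conditions on a product of finite spaces. They form a base by relative complementation
  (`exists_basicOpen_mem_subset`), so each compact open set is a finite union of them and hence
  one of them; and they determine `a` by the prime ideal theorem.

An equivalence of categories induces a bijection on isomorphism classes, and the isomorphisms
between Boolean spaces in the category of perfect maps are the homeomorphisms.
-/

open TopologicalSpace Topology Opposite

/-! ### Compact open sets of Boolean spaces -/

namespace PZLC

theorem exists_compactOpens_mem_subset (X : PZLC.{u}) {x : X} {W : Set X} (hW : W ∈ 𝓝 x) :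
    ∃ U : CompactOpens X, x ∈ U ∧ (U : Set X) ⊆ W := by
  obtain ⟨K, hK, hKW, hKc⟩ := local_compact_nhds hW
  obtain ⟨V, hV, hxV, hVK⟩ := X.isZeroDimensional.mem_nhds_iff.1 hK
  exact ⟨⟨⟨V, hKc.of_isClosed_subset hV.isClosed hVK⟩, hV.isOpen⟩, hxV, hVK.trans hKW⟩

theorem exists_compactOpens_superset (X : PZLC.{u}) {K : Set X} (hK : IsCompact K) :
    ∃ U : CompactOpens X, K ⊆ U := by
  refine hK.induction_on (p := fun s => ∃ U : CompactOpens X, s ⊆ U) ⟨⊥, Set.empty_subset _⟩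
    (fun s t hst ⟨U, hU⟩ => ⟨U, hst.trans hU⟩)
    (fun s t ⟨U, hU⟩ ⟨V, hV⟩ => ⟨U ⊔ V, Set.union_subset_union hU hV⟩) fun x _ => ?_
  obtain ⟨U, hxU, -⟩ := X.exists_compactOpens_mem_subset (x := x) Filter.univ_mem
  exact ⟨U, mem_nhdsWithin_of_mem_nhds (U.isOpen.mem_nhds hxU), U, subset_rfl⟩

theorem exists_compactOpens_mem_notMem (X : PZLC.{u}) {x y : X} (h : x ≠ y) :
    ∃ U : CompactOpens X, x ∈ U ∧ y ∉ U := by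
  obtain ⟨U, hx, hU⟩ := X.exists_compactOpens_mem_subset (isOpen_ne.mem_nhds h)
  exact ⟨U, hx, fun hy => hU hy rfl⟩

end PZLC

theorem IsPerfectMap.isProperMap {X : Type u} {Y : Type v} [TopologicalSpace X]
    [TopologicalSpace Y] {f : X → Y} (hf : IsPerfectMap f) : IsProperMap f :=
  isProperMap_iff_isClosedMap_and_compact_fibers.2
    ⟨hf.continuous, hf.isClosedMap, fun {y} => hf.isCompact_fiber y⟩

theorem IsProperMap.isPerfectMap {X : Type u} {Y : Type v} [TopologicalSpace X]
    [TopologicalSpace Y] {f : X → Y} (hf : IsProperMap f) : IsPerfectMap f where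
  continuous := hf.continuous
  isClosedMap := hf.isClosedMap
  isCompact_fiber _ := hf.isCompact_preimage isCompact_singleton

/-! ### The functor of compact open sets -/

namespace PZLC

/-- The generalized Boolean pseudolattice of compact open sets of a Boolean space. -/
def compactOpens (X : PZLC.{u}) : GBPL.{u} where
  carrier := CompactOpens X
  exists_relative_complement a b c hba hac := by
    refine ⟨b ⊔ c \ a, ?_, ?_⟩
    · rw [inf_sup_left, inf_sdiff_self_right, sup_bot_eq, inf_eq_right.2 hba]
    · rw [← sup_assoc, sup_eq_left.2 hba, sup_sdiff_cancel_right hac]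

/-- Inverse image along a perfect map, as a morphism between the lattices of compact open sets. -/
def Hom.preimage {X Y : PZLC.{u}} (f : PZLC.Hom X Y) :
    GBPL.Hom Y.compactOpens X.compactOpens where
  toFun (U : CompactOpens Y) :=
    (⟨⟨f.toFun ⁻¹' U, f.isPerfectMap.isProperMap.isCompact_preimage U.isCompact⟩,
      U.isOpen.preimage f.isPerfectMap.continuous⟩ : CompactOpens X)
  map_sup _ _ := rfl
  map_inf _ _ := rfl
  map_bot := rfl
  exists_le (K : CompactOpens X) := by
    obtain ⟨U, hU⟩ := Y.exists_compactOpens_superset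
      (K.isCompact.image f.isPerfectMap.continuous)
    exact ⟨U, fun x hx => hU ⟨x, hx, rfl⟩⟩

/-- The contravariant functor of compact open sets. -/
def compactOpensFunctor : PZLC.{u}ᵒᵖ ⥤ GBPL.{u} where
  obj X := X.unop.compactOpens
  map f := Hom.preimage f.unop
  map_id _ := rfl
  map_comp _ _ := rfl

instance : compactOpensFunctor.{u}.Faithful where
  map_injective {X Y} f g h := by
    apply Quiver.Hom.unop_inj
    refine PZLC.Hom.ext (funext fun x => ?_)
    by_contra hne
    obtain ⟨U, hf, hg⟩ := X.unop.exists_compactOpens_mem_notMem hne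
    have hU : f.unop.toFun ⁻¹' (U : Set X.unop) = g.unop.toFun ⁻¹' U :=
      congrArg (SetLike.coe (A := CompactOpens Y.unop)) (congrFun (congrArg GBPL.Hom.toFun h) U)
    exact hg (hU.le hf)

/-- Each point `x` of `X`, viewed as the prime filter of those compact open sets `U` of `Y` with
`x ∈ φ U`, is represented by a point of `Y`. -/
theorem exists_point_of_hom {X Y : PZLC.{u}} {φ : CompactOpens Y → CompactOpens X}
    (map_sup : ∀ U V, φ (U ⊔ V) = φ U ⊔ φ V) (map_inf : ∀ U V, φ (U ⊓ V) = φ U ⊓ φ V)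
    (map_bot : φ ⊥ = ⊥) (exists_le : ∀ K, ∃ U, K ≤ φ U) (x : X) :
    ∃ y : Y, ∀ U : CompactOpens Y, y ∈ U ↔ x ∈ φ U := by
  let S := {U : CompactOpens Y // x ∈ φ U}
  have hinf (U V : CompactOpens Y) : x ∈ φ (U ⊓ V) ↔ x ∈ φ U ∧ x ∈ φ V := by
    rw [map_inf]
    exact Iff.rfl
  have hsup (U V : CompactOpens Y) : x ∈ φ (U ⊔ V) ↔ x ∈ φ U ∨ x ∈ φ V := by
    rw [map_sup]
    exact Iff.rfl
  have hbot : x ∉ φ ⊥ := by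
    rw [map_bot]
    exact fun h => h
  have hne : Nonempty S := by
    obtain ⟨K, hxK, -⟩ := X.exists_compactOpens_mem_subset (x := x) Filter.univ_mem
    obtain ⟨U, hU⟩ := exists_le K
    exact ⟨⟨U, hU hxK⟩⟩
  obtain ⟨y, hy⟩ : (⋂ U : S, (U.1 : Set Y)).Nonempty := by
    refine IsCompact.nonempty_iInter_of_directed_nonempty_isCompact_isClosed _
      (fun U V => ⟨⟨U.1 ⊓ V.1, (hinf _ _).2 ⟨U.2, V.2⟩⟩, Set.inter_subset_left,
        Set.inter_subset_right⟩) (fun U => ?_) (fun U => U.1.isCompact)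
      fun U => U.1.isCompact.isClosed
    by_contra hU
    refine hbot ?_
    rw [← show U.1 = ⊥ from CompactOpens.ext (Set.not_nonempty_iff_eq_empty.1 hU)]
    exact U.2
  rw [Set.mem_iInter] at hy
  refine ⟨y, fun U => ⟨fun hyU => ?_, fun hxU => hy ⟨U, hxU⟩⟩⟩
  by_contra hxU
  obtain ⟨V, hV⟩ := hne
  have hVU : x ∈ φ (V \ U) := by
    rw [← sup_inf_sdiff V U, hsup, hinf] at hV
    exact hV.resolve_left fun h => hxU h.2
  exact (hy ⟨_, hVU⟩).2 hyU

theorem exists_hom_preimage_eq {X Y : PZLC.{u}}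
    (φ : GBPL.Hom Y.compactOpens X.compactOpens) : ∃ f : PZLC.Hom X Y, f.preimage = φ := by
  let ψ : CompactOpens Y → CompactOpens X := φ.toFun
  choose f hf using
    exists_point_of_hom (φ := ψ) φ.map_sup φ.map_inf φ.map_bot φ.exists_le
  have hpre (U : CompactOpens Y) : f ⁻¹' U = ψ U :=
    Set.ext fun x => hf x U
  have hcont : Continuous f := by
    refine continuous_iff_continuousAt.2 fun x W hW => ?_
    obtain ⟨U, hxU, hUW⟩ := Y.exists_compactOpens_mem_subset hW
    have hU : f ⁻¹' U ∈ 𝓝 x := by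
      rw [hpre]
      exact (CompactOpens.isOpen _).mem_nhds ((hf x U).1 hxU)
    exact Filter.mem_of_superset hU (Set.preimage_mono hUW)
  have hproper : IsProperMap f := by
    refine isProperMap_iff_isCompact_preimage.2 ⟨hcont, fun K hK => ?_⟩
    obtain ⟨U, hU⟩ := Y.exists_compactOpens_superset hK
    have hc : IsCompact (f ⁻¹' U) := by
      rw [hpre]
      exact CompactOpens.isCompact _
    exact hc.of_isClosed_subset (hK.isClosed.preimage hcont) (Set.preimage_mono hU)
  exact ⟨⟨f, hproper.isPerfectMap⟩,
    GBPL.Hom.ext (funext fun U => CompactOpens.ext (hpre U))⟩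

instance : compactOpensFunctor.{u}.Full where
  map_surjective φ := by
    obtain ⟨f, hf⟩ := exists_hom_preimage_eq φ
    exact ⟨Quiver.Hom.op f, hf⟩

end PZLC

/-! ### The spectrum of a generalized Boolean pseudolattice -/

namespace GBPL

/-- The spectrum of a generalized Boolean pseudolattice `A`: the nonzero maps from `A` to the
two-element lattice that preserve binary joins, binary meets and `⊥`. These are the
characteristic functions of the prime filters of `A`. The topology is that of pointwise
convergence; `Bool` is used rather than `Prop` because its topology is discrete. -/
abbrev Spectrum (A : GBPL.{u}) : Type u :=
  {p : A → Bool // ((∀ a b, p (a ⊔ b) = (p a || p b)) ∧ (∀ a b, p (a ⊓ b) = (p a && p b)) ∧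
    p ⊥ = false) ∧ ∃ a, p a = true}

namespace Spectrum

variable {A : GBPL.{u}}

theorem map_sup (p : A.Spectrum) (a b : A) : p.1 (a ⊔ b) = (p.1 a || p.1 b) := p.2.1.1 a b

theorem map_inf (p : A.Spectrum) (a b : A) : p.1 (a ⊓ b) = (p.1 a && p.1 b) := p.2.1.2.1 a b

theorem map_bot (p : A.Spectrum) : p.1 ⊥ = false := p.2.1.2.2

theorem continuous_eval (a : A) : Continuous fun p : A.Spectrum => p.1 a :=
  (continuous_apply a).comp continuous_subtype_val

theorem isOpen_setOf_eq_true (a : A) : IsOpen {p : A.Spectrum | p.1 a = true} :=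
  (isOpen_discrete {true}).preimage (continuous_eval a)

theorem isCompact_setOf_eq_true (a : A) : IsCompact {p : A.Spectrum | p.1 a = true} := by
  rw [Subtype.isCompact_iff]
  -- Requiring the value `true` at `a` forces a map to be nonzero, so the image in the product is
  -- cut out by closed conditions alone.
  have himage : ((↑) : A.Spectrum → A → Bool) '' {p : A.Spectrum | p.1 a = true} =
      {p | ((∀ a b, p (a ⊔ b) = (p a || p b)) ∧ (∀ a b, p (a ⊓ b) = (p a && p b)) ∧
        p ⊥ = false) ∧ p a = true} := by
    ext p
    exact ⟨by rintro ⟨q, hq, rfl⟩; exact ⟨q.2.1, hq⟩, fun h => ⟨⟨p, h.1, a, h.2⟩, h.2, rfl⟩⟩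
  rw [himage]
  have hor (a b : A) : Continuous fun p : A → Bool => (p a || p b) :=
    (continuous_of_discreteTopology (f := fun c : Bool × Bool => (c.1 || c.2))).comp
      (f := fun p : A → Bool => (p a, p b)) ((continuous_apply a).prodMk (continuous_apply b))
  have hand (a b : A) : Continuous fun p : A → Bool => (p a && p b) :=
    (continuous_of_discreteTopology (f := fun c : Bool × Bool => (c.1 && c.2))).comp
      (f := fun p : A → Bool => (p a, p b)) ((continuous_apply a).prodMk (continuous_apply b))
  refine IsClosed.isCompact (((IsClosed.and ?_ (IsClosed.and ?_ ?_))).and ?_)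
  · simp only [Set.ofPred_forall]
    exact isClosed_iInter fun a => isClosed_iInter fun b => isClosed_eq
      (continuous_apply _) (hor a b)
  · simp only [Set.ofPred_forall]
    exact isClosed_iInter fun a => isClosed_iInter fun b => isClosed_eq
      (continuous_apply _) (hand a b)
  · exact isClosed_eq (continuous_apply _) continuous_const
  · exact isClosed_eq (continuous_apply _) continuous_const

/-- The compact open set of those points of the spectrum that take the value `true` at `a`. -/
def basicOpen (a : A) : CompactOpens A.Spectrum :=
  ⟨⟨{p | p.1 a = true}, isCompact_setOf_eq_true a⟩, isOpen_setOf_eq_true a⟩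

@[simp]
theorem mem_basicOpen {a : A} {p : A.Spectrum} : p ∈ basicOpen a ↔ p.1 a = true := Iff.rfl

theorem basicOpen_sup (a b : A) : basicOpen (a ⊔ b) = basicOpen a ⊔ basicOpen b :=
  CompactOpens.ext <| Set.ext fun p => by
    change p.1 (a ⊔ b) = true ↔ p.1 a = true ∨ p.1 b = true
    rw [p.map_sup, Bool.or_eq_true]

theorem basicOpen_inf (a b : A) : basicOpen (a ⊓ b) = basicOpen a ⊓ basicOpen b :=
  CompactOpens.ext <| Set.ext fun p => by
    change p.1 (a ⊓ b) = true ↔ p.1 a = true ∧ p.1 b = true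
    rw [p.map_inf, Bool.and_eq_true]

theorem basicOpen_bot : basicOpen (⊥ : A) = ⊥ :=
  CompactOpens.ext <| Set.ext fun p => by
    change p.1 ⊥ = true ↔ False
    simp [p.map_bot]

theorem exists_mem_basicOpen (p : A.Spectrum) : ∃ a, p ∈ basicOpen a := p.2.2

theorem exists_mem_basicOpen_notMem {p q : A.Spectrum} (h : p ≠ q) :
    ∃ a, p ∈ basicOpen a ∧ q ∉ basicOpen a := by
  obtain ⟨b, hb⟩ : ∃ b, p.1 b ≠ q.1 b := by
    by_contra! hpq
    exact h (Subtype.ext (funext hpq))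
  by_cases hpb : p.1 b = true
  · exact ⟨b, hpb, fun hq => hb (hpb.trans hq.symm)⟩
  · have hqb : q.1 b = true := by
      rw [Bool.not_eq_true] at hpb
      rw [hpb] at hb
      exact Bool.eq_true_of_not_eq_false hb.symm
    obtain ⟨a, ha⟩ := p.exists_mem_basicOpen
    -- The witness is the relative complement `a \ b`.
    obtain ⟨x, hx_inf, hx_sup⟩ := A.exists_relative_complement (a ⊓ b) ⊥ a bot_le inf_le_left
    have hp := p.map_sup (a ⊓ b) x
    have hq := q.map_inf (a ⊓ b) x
    have hxa := q.map_inf a x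
    rw [inf_eq_right.2 (le_sup_right.trans hx_sup.le)] at hxa
    rw [hx_sup, p.map_inf] at hp
    rw [hx_inf, q.map_inf, q.map_bot] at hq
    rw [mem_basicOpen] at ha
    refine ⟨x, ?_, ?_⟩
    · simpa [ha, hpb] using hp
    · rw [mem_basicOpen]
      intro hqx
      rw [hqx, Bool.and_true] at hxa
      rw [← hxa, hqb, hqx] at hq
      simp at hq

theorem exists_basicOpen_mem_subset {p : A.Spectrum} {W : Set A.Spectrum} (hW : W ∈ 𝓝 p) :
    ∃ a, p ∈ basicOpen a ∧ (basicOpen a : Set A.Spectrum) ⊆ W := by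
  have hne : Nonempty {a : A // p ∈ basicOpen a} := nonempty_subtype.2 p.exists_mem_basicOpen
  obtain ⟨a, ha⟩ := exists_subset_nhds_of_isCompact'
    (V := fun a : {a : A // p ∈ basicOpen a} => (basicOpen a.1 : Set A.Spectrum)) (U := W)
    (fun a b => ⟨⟨a.1 ⊓ b.1, (basicOpen_inf a.1 b.1).ge ⟨a.2, b.2⟩⟩,
      (basicOpen_inf a.1 b.1).le.trans inf_le_left,
      (basicOpen_inf a.1 b.1).le.trans inf_le_right⟩)
    (fun a => (basicOpen a.1).isCompact) (fun a => (basicOpen a.1).isCompact.isClosed)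
    fun q hq => by
      -- The basic open sets containing `p` have no other common point.
      by_cases hpq : p = q
      · rwa [← hpq]
      · obtain ⟨a, hp, hqa⟩ := exists_mem_basicOpen_notMem hpq
        exact (hqa (Set.mem_iInter.1 hq ⟨a, hp⟩)).elim
  exact ⟨a.1, a.2, ha⟩

theorem basicOpen_surjective : Function.Surjective (basicOpen (A := A)) := by
  intro W
  obtain ⟨a, hWa, haW⟩ := W.isCompact.induction_on
    (p := fun s => ∃ a : A, s ⊆ basicOpen a ∧ basicOpen a ≤ W)
    ⟨⊥, Set.empty_subset _, by rw [basicOpen_bot]; exact bot_le⟩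
    (fun s t hst ⟨a, h, h'⟩ => ⟨a, hst.trans h, h'⟩)
    (fun s t ⟨a, ha, ha'⟩ ⟨b, hb, hb'⟩ => ⟨a ⊔ b, by
      rw [basicOpen_sup]; exact Set.union_subset_union ha hb, by
      rw [basicOpen_sup]; exact sup_le ha' hb'⟩)
    (fun p hp => by
      obtain ⟨a, hpa, haW⟩ := exists_basicOpen_mem_subset (W.isOpen.mem_nhds hp)
      exact ⟨basicOpen a, mem_nhdsWithin_of_mem_nhds ((basicOpen a).isOpen.mem_nhds hpa), a,
        subset_rfl, haW⟩)
  exact ⟨a, le_antisymm haW hWa⟩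

/-- The spectrum has enough points: if `a ≰ b`, then the prime ideal theorem gives a prime ideal
that contains `b` but not `a`. -/
theorem le_of_basicOpen_le {a b : A} (h : basicOpen a ≤ basicOpen b) : a ≤ b := by
  classical
  by_contra hab
  have hdisj : Disjoint (Order.PFilter.principal a : Set A) (Order.Ideal.principal b : Set A) :=
    Set.disjoint_left.2 fun c hac hcb => hab (le_trans hac hcb)
  obtain ⟨J, hJ, hbJ, haJ⟩ := DistribLattice.prime_ideal_of_disjoint_filter_ideal hdisj
  have ha : a ∉ J := Set.disjoint_left.1 haJ (le_refl a)
  have hb : b ∈ J := hbJ (le_refl b)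
  -- The point is the characteristic function of the complement of the prime ideal `J`.
  let p : A.Spectrum := ⟨fun c => decide (c ∉ J), ⟨fun c d => by
      simp [Order.Ideal.sup_mem_iff, -not_and, not_and_or], fun c d => ?_, by simp⟩,
    a, decide_eq_true ha⟩
  · have hp : p ∈ basicOpen b := h (show p.1 a = true from decide_eq_true ha)
    exact of_decide_eq_true hp hb
  · have hcd : c ⊓ d ∈ J ↔ c ∈ J ∨ d ∈ J :=
      ⟨hJ.mem_or_mem, fun h => h.elim (J.lower inf_le_left) (J.lower inf_le_right)⟩
    simp [hcd]

theorem basicOpen_injective : Function.Injective (basicOpen (A := A)) := fun _ _ h =>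
  le_antisymm (le_of_basicOpen_le h.le) (le_of_basicOpen_le h.ge)

end Spectrum

/-- The spectrum of a generalized Boolean pseudolattice, as a Boolean space. -/
def spectrum (A : GBPL.{u}) : PZLC.{u} :=
  haveI : WeaklyLocallyCompactSpace A.Spectrum := ⟨fun p =>
    let ⟨a, ha⟩ := p.exists_mem_basicOpen
    ⟨Spectrum.basicOpen a, (Spectrum.basicOpen a).isCompact,
      (Spectrum.basicOpen a).isOpen.mem_nhds ha⟩⟩
  { carrier := A.Spectrum
    isZeroDimensional := isTopologicalBasis_of_isOpen_of_nhds (fun _ h => h.isOpen)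
      fun _ _ hp hW =>
        let ⟨a, ha, haW⟩ := Spectrum.exists_basicOpen_mem_subset (hW.mem_nhds hp)
        ⟨Spectrum.basicOpen a, (Spectrum.basicOpen a).toClopens.isClopen, ha, haW⟩ }

theorem isIso_of_bijective {A B : GBPL.{u}} (f : A ⟶ B) (hf : Function.Bijective f.toFun) :
    IsIso f := by
  let e := Equiv.ofBijective f.toFun hf
  have he (b : B) : f.toFun (e.symm b) = b := e.apply_symm_apply b
  let g : GBPL.Hom B A :=
    { toFun := e.symm
      map_sup := fun a b => hf.1 (by rw [f.map_sup, he, he, he])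
      map_inf := fun a b => hf.1 (by rw [f.map_inf, he, he, he])
      map_bot := hf.1 (by rw [f.map_bot, he])
      exists_le := fun a => ⟨f.toFun a, (e.symm_apply_apply a).ge⟩ }
  exact ⟨g, GBPL.Hom.ext (funext e.symm_apply_apply), GBPL.Hom.ext (funext he)⟩

/-- The representation of a generalized Boolean pseudolattice by the compact open sets of its
spectrum. -/
def toCompactOpensSpectrum (A : GBPL.{u}) : GBPL.Hom A A.spectrum.compactOpens where
  toFun a := Spectrum.basicOpen a
  map_sup := Spectrum.basicOpen_sup
  map_inf := Spectrum.basicOpen_inf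
  map_bot := Spectrum.basicOpen_bot
  exists_le b := (Spectrum.basicOpen_surjective b).imp fun _ h => h.ge

end GBPL

/-! ### The duality -/

namespace PZLC

instance : compactOpensFunctor.{u}.EssSurj where
  mem_essImage A := by
    have := GBPL.isIso_of_bijective (B := A.spectrum.compactOpens) A.toCompactOpensSpectrum
      ⟨GBPL.Spectrum.basicOpen_injective, GBPL.Spectrum.basicOpen_surjective⟩
    exact ⟨op A.spectrum, ⟨(asIso (Y := A.spectrum.compactOpens) A.toCompactOpensSpectrum).symm⟩⟩

instance : compactOpensFunctor.{u}.IsEquivalence where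

theorem nonempty_iso_iff_nonempty_homeomorph {X Y : PZLC.{u}} :
    Nonempty (X ≅ Y) ↔ Nonempty (X ≃ₜ Y) := by
  constructor
  · rintro ⟨i⟩
    exact ⟨{ toFun := i.hom.toFun
             invFun := i.inv.toFun
             left_inv := congrFun (congrArg Hom.toFun i.hom_inv_id)
             right_inv := congrFun (congrArg Hom.toFun i.inv_hom_id)
             continuous_toFun := i.hom.isPerfectMap.continuous
             continuous_invFun := i.inv.isPerfectMap.continuous }⟩
  · rintro ⟨h⟩
    exact ⟨{ hom := ⟨h, h.isProperMap.isPerfectMap⟩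
             inv := ⟨h.symm, h.symm.isProperMap.isPerfectMap⟩
             hom_inv_id := Hom.ext (funext h.symm_apply_apply)
             inv_hom_id := Hom.ext (funext h.apply_symm_apply) }⟩

theorem nonempty_homeomorph_iff_nonempty_iso_compactOpens {X Y : PZLC.{u}} :
    Nonempty (X ≃ₜ Y) ↔ Nonempty (X.compactOpens ≅ Y.compactOpens) := by
  rw [← nonempty_iso_iff_nonempty_homeomorph]
  exact ⟨fun ⟨i⟩ => ⟨compactOpensFunctor.mapIso i.symm.op⟩, fun ⟨i⟩ =>
    ⟨(compactOpensFunctor.preimageIso (X := op X) (Y := op Y) i).symm.unop⟩⟩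

end PZLC

/-- There is a duality between `PZLC` and `GBPL`, and its object map induces a bijection between
the homeomorphism classes of Boolean spaces and the isomorphism classes of generalized Boolean
pseudolattices. -/
theorem theorem1p22 :
    ∃ (e : PZLC.{u}ᵒᵖ ≌ GBPL.{u})
      (Φ : Quotient PZLC.homeomorphicSetoid.{u} ≃ Quotient (isIsomorphicSetoid GBPL.{u})),
      ∀ X : PZLC.{u},
        Φ (Quotient.mk PZLC.homeomorphicSetoid X) =
          Quotient.mk (isIsomorphicSetoid GBPL.{u}) (e.functor.obj (Opposite.op X)) := by
  refine ⟨PZLC.compactOpensFunctor.asEquivalence, Equiv.ofBijective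
    (Quotient.map PZLC.compactOpens fun X Y h =>
      PZLC.nonempty_homeomorph_iff_nonempty_iso_compactOpens.1 h) ⟨?_, ?_⟩, fun X => rfl⟩
  · rintro ⟨X⟩ ⟨Y⟩ h
    exact Quotient.sound
      (PZLC.nonempty_homeomorph_iff_nonempty_iso_compactOpens.2 (Quotient.exact h))
  · rintro ⟨A⟩
    exact ⟨Quotient.mk _ (PZLC.compactOpensFunctor.objPreimage A).unop,
      Quotient.sound ⟨PZLC.compactOpensFunctor.objObjPreimageIso A⟩⟩
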